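/- Let $S=(S_t)_{t\ge 0}$ be a subordinator, i.e. a real-valued Lévy process with $S_0=0$ a.s. and $S_t\ge 0$ a.s. for every $t$, with Laplace exponent $\phi(\lambda)=-\log \mathbb{E}[e^{-\lambda S_1}]$, $\lambda>0$, and potential measure $U(A)=\mathbb{E}\left[\int_0^\infty \mathbf 1_{\{S_t\in A\}}\,dt\right]$ on $[0,\infty)$. Let $d\ge 3$ and let $X_t=B(S_t)$ be the corresponding subordinate Brownian motion in $\mathbb{R}^d$, where $B$ is a Brownian motion independent of $S$ with transition density $(4\pi t)^{-d/2}e^{-|x-y|^2/(4t)}$. Thus $X$ has transition density $$p(t,x,y)=\int_{[0,\infty)}(4\pi s)^{-d/2}e^{-\frac{|x-y|^2}{4s}}\,\mathbb{P}(S_t\in ds)$$ for $x\ne y$ (where the integrand is $0$ at $s=0$), and Green function $G(x,y)=\int_0^\infty p(t,x,y)\,dt$. Put $$g(r)=\int_{(0,\infty)}(4\pi t)^{-d/2}e^{-\frac{r^2}{4t}}\,U(dt),\qquad r>0.$$ Assume that for some $\alpha\in[0,2]$: * (A-1) $\phi'>0$ and $\phi'$ varies regularly at infinity with index $\frac{\alpha}{2}-1$,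 i.e. $\lim_{\lambda\to\infty}\frac{\phi'(\lambda x)}{\phi'(\lambda)}=x^{\frac{\alpha}{2}-1}$ for every $x>0$; * (A-3) $U$ has a decreasing (i.e. non-increasing) density $u:(0,\infty)\to[0,\infty)$ with respect to Lebesgue measure. Then $G(x,y)=g(|y-x|)<\infty$ for all $x\neq y$ in $\mathbb{R}^d$, and the following holds. If $\alpha\in[0,2)$, then $$g(r)\asymp r^{-d-2}\,\frac{\phi'(r^{-2})}{\phi(r^{-2})^2},\qquad r\to 0+.$$ If $\alpha=2$, then $$g(r)\asymp \frac{r^{-d+2}}{\phi'(r^{-2})}\asymp \frac{r^{-d}}{\phi(r^{-2})},\qquad r\to 0+.$$ Here $f(r)\asymp h(r)$ as $r\to 0+$ means that $f/h$ stays between two positive constants on some interval $(0,r_0)$. -/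

import Mathlib

open MeasureTheory ProbabilityTheory Filter Set Topology
open scoped NNReal ENNReal

noncomputable section

namespace SubordinateBM

variable {Ω : Type*} [MeasurableSpace Ω]

/-- A subordinator on `(Ω, P)`: a real-valued Lévy process (started at `0`, with independent and
stationary increments and almost surely right continuous paths with left limits) whose values are
non-negative. -/
structure IsSubordinator (S : ℝ≥0 → Ω → ℝ) (P : Measure Ω) : Prop where
  measurable : ∀ t, Measurable (S t)
  zero : ∀ᵐ ω ∂P, S 0 ω = 0
  indep : HasIndepIncrements S P
  stationary : ∀ s t h : ℝ≥0,
    IdentDistrib (fun ω => S (s + h) ω - S s ω) (fun ω => S (t + h) ω - S t ω) P P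
  cadlag : ∀ᵐ ω ∂P, ∀ t : ℝ≥0,
    ContinuousWithinAt (fun s => S s ω) (Ici t) t ∧
      ∃ l : ℝ, Tendsto (fun s => S s ω) (𝓝[<] t) (𝓝 l)
  nonneg : ∀ t, ∀ᵐ ω ∂P, 0 ≤ S t ω

/-- The Laplace exponent `φ(lam) = -log E[exp (-lam S₁)]`. -/
def laplaceExponent (S : ℝ≥0 → Ω → ℝ) (P : Measure Ω) (lam : ℝ) : ℝ :=
  -Real.log (∫ ω, Real.exp (-lam * S 1 ω) ∂P)

/-- The potential measure `U(A) = E[∫₀^∞ 1_{S_t ∈ A} dt]`, as the image of `P ⊗ dt` under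
`(ω, t) ↦ S_t(ω)`; see `potentialMeasure_apply`. -/
def potentialMeasure (S : ℝ≥0 → Ω → ℝ) (P : Measure Ω) : Measure ℝ :=
  (P.prod (volume.restrict (Ioi (0 : ℝ)))).map (fun p => S p.2.toNNReal p.1)

/-- A subordinator is jointly measurable in `(ω, t)`, up to a null set. -/
theorem IsSubordinator.aemeasurable_uncurry {S : ℝ≥0 → Ω → ℝ} {P : Measure Ω}
    [IsProbabilityMeasure P] (hS : IsSubordinator S P) :
    AEMeasurable (fun p : Ω × ℝ => S p.2.toNNReal p.1)
      (P.prod (volume.restrict (Ioi (0 : ℝ)))) := by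
  have hmeas : ∀ n : ℕ, Measurable (fun p : Ω × ℝ =>
      S (((⌊p.2.toNNReal * ((n : ℝ≥0) + 1)⌋₊ : ℝ≥0) + 1) / ((n : ℝ≥0) + 1)) p.1) := by
    intro n
    have h1 : ∀ c : ℕ → ℝ≥0, Measurable (fun q : Ω × ℕ => S (c q.2) q.1) := fun c =>
      measurable_from_prod_countable_left (fun k => hS.measurable (c k))
    have h3 : Measurable (fun p : Ω × ℝ => ⌊p.2.toNNReal * ((n : ℝ≥0) + 1)⌋₊) := by
      have h4 : Measurable (fun p : Ω × ℝ => p.2.toNNReal * ((n : ℝ≥0) + 1)) :=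
        measurable_snd.real_toNNReal.mul_const _
      exact Nat.measurable_floor.comp h4
    have h2 : Measurable (fun p : Ω × ℝ => (p.1, ⌊p.2.toNNReal * ((n : ℝ≥0) + 1)⌋₊)) :=
      measurable_fst.prodMk h3
    have h5 : ∀ c : ℕ → ℝ≥0, Measurable (fun p : Ω × ℝ =>
        S (c ⌊p.2.toNNReal * ((n : ℝ≥0) + 1)⌋₊) p.1) := fun c => (h1 c).comp h2
    exact h5 (fun k => ((k : ℝ≥0) + 1) / ((n : ℝ≥0) + 1))
  refine aemeasurable_of_tendsto_metrizable_ae atTop (fun n => (hmeas n).aemeasurable) ?_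
  have hq := (Measure.quasiMeasurePreserving_fst (μ := P)
    (ν := volume.restrict (Ioi (0 : ℝ)))).ae hS.cadlag
  filter_upwards [hq] with p hp
  generalize p.2.toNNReal = t
  have hge : ∀ n : ℕ, t ≤ ((⌊t * ((n : ℝ≥0) + 1)⌋₊ : ℝ≥0) + 1) / ((n : ℝ≥0) + 1) := by
    intro n
    have hn : (0 : ℝ≥0) < (n : ℝ≥0) + 1 := by positivity
    rw [le_div_iff₀ hn]
    exact (Nat.lt_floor_add_one _).le
  have hle : ∀ n : ℕ, ((⌊t * ((n : ℝ≥0) + 1)⌋₊ : ℝ≥0) + 1) / ((n : ℝ≥0) + 1)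
      ≤ t + 1 / ((n : ℝ≥0) + 1) := by
    intro n
    have hn : (0 : ℝ≥0) < (n : ℝ≥0) + 1 := by positivity
    rw [add_div]
    gcongr
    rw [div_le_iff₀ hn]
    exact Nat.floor_le (by positivity)
  have hlim : Tendsto (fun n : ℕ => t + 1 / ((n : ℝ≥0) + 1)) atTop (𝓝 t) := by
    have := (tendsto_one_div_add_atTop_nhds_zero_nat (𝕜 := ℝ≥0)).const_add t
    simpa using this
  refine (hp t).1.tendsto.comp (tendsto_nhdsWithin_iff.2
    ⟨tendsto_of_tendsto_of_tendsto_of_le_of_le tendsto_const_nhds hlim hge hle,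
      Eventually.of_forall hge⟩)

/-- `U(A) = E[∫₀^∞ 1_{S_t ∈ A} dt]`. -/
theorem potentialMeasure_apply {S : ℝ≥0 → Ω → ℝ} {P : Measure Ω} [IsProbabilityMeasure P]
    (hS : IsSubordinator S P) {A : Set ℝ} (hA : MeasurableSet A) :
    potentialMeasure S P A =
      ∫⁻ ω, ∫⁻ t in Ioi (0 : ℝ), A.indicator 1 (S t.toNNReal ω) ∂volume ∂P := by
  have h := hS.aemeasurable_uncurry
  have h1 : Measurable (A.indicator (1 : ℝ → ℝ≥0∞)) := measurable_one.indicator hA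
  rw [← lintegral_indicator_one hA, potentialMeasure, lintegral_map' h1.aemeasurable h]
  exact lintegral_prod _ (h1.comp_aemeasurable h)

/-- The measure `U` (living on `[0, ∞)`) has a decreasing density `u : (0, ∞) → [0, ∞)` with
respect to Lebesgue measure. In particular `U` has no atom at `0`. -/
def HasDecreasingDensity (U : Measure ℝ) : Prop :=
  ∃ u : ℝ → ℝ, AntitoneOn u (Ioi 0) ∧ (∀ t ∈ Ioi (0 : ℝ), 0 ≤ u t) ∧
    U = (volume.restrict (Ioi 0)).withDensity (fun t => ENNReal.ofReal (u t))

/-- `f : (0, ∞) → (0, ∞)` varies regularly at infinity with index `ρ`. -/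
def RegularlyVarying (f : ℝ → ℝ) (ρ : ℝ) : Prop :=
  (∀ lam : ℝ, 0 < lam → 0 < f lam) ∧
    ∀ x : ℝ, 0 < x → Tendsto (fun lam => f (lam * x) / f lam) atTop (𝓝 (x ^ ρ))

/-- The Gaussian kernel `(4πt)^{-d/2} exp(-r²/(4t))`; for `t = 0 < d` its Lean value is `0`, which
is its limit as `t → 0+` when `r > 0`. -/
def gaussKernel (d : ℕ) (t r : ℝ) : ℝ :=
  (4 * Real.pi * t) ^ (-(d : ℝ) / 2) * Real.exp (-r ^ 2 / (4 * t))

/-- The transition density of the subordinate Brownian motion `X_t = B(S_t)` in `ℝ^d`,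
`p(t,x,y) = ∫_{[0,∞)} (4πs)^{-d/2} exp(-|x-y|²/(4s)) P(S_t ∈ ds)`. -/
def transitionDensity (S : ℝ≥0 → Ω → ℝ) (P : Measure Ω) {d : ℕ} (t : ℝ≥0)
    (x y : EuclideanSpace ℝ (Fin d)) : ℝ≥0∞ :=
  ∫⁻ s in Ici 0, ENNReal.ofReal (gaussKernel d s ‖x - y‖) ∂(P.map (S t))

/-- The Green function of `X`, `G(x,y) = ∫_{(0,∞)} p(t,x,y) dt`. -/
def greenFunction (S : ℝ≥0 → Ω → ℝ) (P : Measure Ω) {d : ℕ}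
    (x y : EuclideanSpace ℝ (Fin d)) : ℝ≥0∞ :=
  ∫⁻ t in Ioi (0 : ℝ), transitionDensity S P t.toNNReal x y

/-- The radial profile of the Green function,
`g(r) = ∫_{(0,∞)} (4πt)^{-d/2} exp(-r²/(4t)) U(dt)`. -/
def greenRadial (S : ℝ≥0 → Ω → ℝ) (P : Measure Ω) (d : ℕ) (r : ℝ) : ℝ :=
  ∫ t in Ioi 0, gaussKernel d t r ∂(potentialMeasure S P)

/-- `f(r) ≍ h(r)` as `r → 0+`: the quotient `f/h` stays between two positive constants on some
interval `(0, r₀)`. -/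
def AsympNearZero (f h : ℝ → ℝ) : Prop :=
  ∃ c₁ c₂ : ℝ, 0 < c₁ ∧ 0 < c₂ ∧ ∀ᶠ r in 𝓝[>] (0 : ℝ), c₁ ≤ f r / h r ∧ f r / h r ≤ c₂

end SubordinateBM

end

/-!
The potential measure `U` has Laplace transform `1 / φ`, because `E[exp (-lam S_t)] = exp (-t φ(lam))`
(`SubordinateBM.IsSubordinator.integral_exp`). Differentiating, `F = φ' / φ²` is the Laplace transform
of `t U(dt) = t u(t) dt` (`SubordinateBM.IsSubordinator.lintegral_mul_exp_potentialMeasure`), and the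
whole proof compares `g` with `F`.

Since `u` decreases, `u(a) a² / 2 ≤ ∫₀^a t u(t) dt ≤ e F(1/a)` for every `a > 0`
(`SubordinateBM.density_mul_sq_le`). Conversely, splitting the integral defining `F(lam)` at `b` gives
`F(lam) ≤ e F(1/b) + 4 u(b) / lam²` (`SubordinateBM.laplace_le_add_density`). If
`F(2w) ≤ q F(w)` for some `q < 1` and all large `w`, then with `b = 2^(-n) / lam` and `n` large the
first term on the right is at most `F(lam) / 2`, whence `u(t) ≥ c t⁻² F(1/t)` for small `t`
(`SubordinateBM.exists_le_density_mul_sq`).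

The geometric decay of `F` comes from regular variation (`SubordinateBM.exists_doubling_le`). If
`α < 2`, then `φ'` itself decays geometrically and `φ` increases. If `α = 2`, then `φ'` is slowly
varying, so `φ(w)` is comparable to `w φ'(w)` (`SubordinateBM.mul_deriv_le`,
`SubordinateBM.exists_le_mul_deriv`), and the concave function `φ` gains a fixed factor when `w` is
doubled.

Finally, the Gaussian kernel concentrates `g(r)` at times of order `r²`: the bound
`g(r) ≤ C r^(-d-2) F(r⁻²)` holds for all `r` (`SubordinateBM.lintegral_gaussKernel_le`; this also gives
finiteness), and `g(r) ≥ c r^(-d+2) u(r²)` (`SubordinateBM.le_lintegral_gaussKernel`). Hence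
`g(r) ≍ r^(-d-2) F(r⁻²)` for all `α`, and for `α = 2` the other two forms follow from
`φ(w) ≍ w φ'(w)`.
-/

namespace SubordinateBM

/-! ### Subordinators and their Laplace exponents -/

/-- An additive function `f : [0, ∞) → [0, ∞)` is linear. -/
theorem eq_mul_of_additive_of_nonneg {f : ℝ≥0 → ℝ} (hadd : ∀ s t, f (s + t) = f s + f t)
    (hnn : ∀ t, 0 ≤ f t) (t : ℝ≥0) : f t = t * f 1 := by
  have hmono : Monotone f := fun a b hab => by
    rw [← add_tsub_cancel_of_le hab, hadd]
    exact le_add_of_nonneg_right (hnn _)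
  have hzero : f 0 = 0 := by simpa using hadd 0 0
  have hnat : ∀ (n : ℕ) (s : ℝ≥0), f (n * s) = n * f s := by
    intro n s
    induction n with
    | zero => simp [hzero]
    | succ n ih => push_cast; rw [add_mul, hadd, ih]; simp; ring
  -- comparing with the floor and the ceiling of `n * t` bounds `n * |f t - t * f 1|` by `f 1`
  have key : ∀ n : ℕ, n * |f t - t * f 1| ≤ f 1 := by
    intro n
    have h1 : (⌊(n : ℝ≥0) * t⌋₊ : ℝ≥0) ≤ n * t := Nat.floor_le (by positivity)
    have h2 : (n : ℝ≥0) * t ≤ ((⌊(n : ℝ≥0) * t⌋₊ + 1 : ℕ) : ℝ≥0) := by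
      push_cast; exact (Nat.lt_floor_add_one _).le
    have h3 := hmono h1
    have h4 := hmono h2
    rw [hnat] at h3 h4
    have h5 := hnat ⌊(n : ℝ≥0) * t⌋₊ 1
    have h6 := hnat (⌊(n : ℝ≥0) * t⌋₊ + 1) 1
    rw [mul_one] at h5 h6
    rw [h5] at h3
    rw [h6] at h4
    have h7 : ((⌊(n : ℝ≥0) * t⌋₊ : ℕ) : ℝ) ≤ n * t := by exact_mod_cast h1
    have h8 : (n : ℝ) * t ≤ ((⌊(n : ℝ≥0) * t⌋₊ + 1 : ℕ) : ℝ) := by exact_mod_cast h2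
    have h9 := mul_le_mul_of_nonneg_right h7 (hnn 1)
    have h10 := mul_le_mul_of_nonneg_right h8 (hnn 1)
    push_cast at h4 h10
    have : (n : ℝ) * |f t - t * f 1| = |n * f t - n * t * f 1| := by
      rw [← abs_of_nonneg (Nat.cast_nonneg (α := ℝ) n), ← abs_mul, abs_of_nonneg
        (Nat.cast_nonneg (α := ℝ) n)]
      congr 1; ring
    rw [this, abs_le]
    constructor <;> linarith
  by_contra hne
  have hpos : 0 < |f t - t * f 1| := abs_pos.2 (sub_ne_zero.2 hne)
  obtain ⟨n, hn⟩ := exists_nat_gt (f 1 / |f t - t * f 1|)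
  rw [div_lt_iff₀ hpos] at hn
  exact absurd (key n) (not_le.2 hn)

variable {Ω : Type*} [MeasurableSpace Ω] {P : Measure Ω} {S : ℝ≥0 → Ω → ℝ}

theorem IsSubordinator.identDistrib_sub (hS : IsSubordinator S P) (s t : ℝ≥0) :
    IdentDistrib (S (s + t) - S s) (S t) P P := by
  refine (hS.stationary s 0 t).trans ?_
  refine IdentDistrib.of_ae_eq ((hS.measurable _).sub (hS.measurable _)).aemeasurable ?_
  filter_upwards [hS.zero] with ω hω
  simp [hω]

variable [IsProbabilityMeasure P]

theorem IsSubordinator.integrable_exp (hS : IsSubordinator S P) (t : ℝ≥0) {lam : ℝ}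
    (hlam : 0 ≤ lam) : Integrable (fun ω => Real.exp (-lam * S t ω)) P := by
  refine Integrable.of_bound (C := 1) ?_ ?_
  · exact (((hS.measurable t).const_mul _).exp).aestronglyMeasurable
  · filter_upwards [hS.nonneg t] with ω hω
    rw [Real.norm_eq_abs, abs_of_pos (Real.exp_pos _), Real.exp_le_one_iff]
    nlinarith

theorem IsSubordinator.cgf_add (hS : IsSubordinator S P) {lam : ℝ} (hlam : 0 ≤ lam)
    (s t : ℝ≥0) :
    cgf (S (s + t)) P (-lam) = cgf (S s) P (-lam) + cgf (S t) P (-lam) := by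
  have hid := hS.identDistrib_sub s t
  have hind : IndepFun (S s) (S (s + t) - S s) P :=
    hS.indep.indepFun_eval_sub (r := 0) zero_le (le_add_of_nonneg_right zero_le) hS.zero
  have hint : Integrable (fun ω => Real.exp (-lam * (S (s + t) - S s) ω)) P :=
    (hid.comp (u := fun x => Real.exp (-lam * x)) (by fun_prop)).integrable_iff.2
      (hS.integrable_exp t hlam)
  have h := hind.cgf_add (hS.integrable_exp s hlam) hint
  rw [add_sub_cancel] at h
  rw [h]
  congr 1
  rw [cgf, cgf, mgf_congr_identDistrib hid]

theorem IsSubordinator.cgf_nonpos (hS : IsSubordinator S P) {lam : ℝ} (hlam : 0 ≤ lam)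
    (t : ℝ≥0) : cgf (S t) P (-lam) ≤ 0 := by
  refine Real.log_nonpos mgf_nonneg ?_
  have h : mgf (S t) P (-lam) ≤ ∫ _, (1 : ℝ) ∂P := by
    refine integral_mono_ae (hS.integrable_exp t hlam) (integrable_const _) ?_
    filter_upwards [hS.nonneg t] with ω hω
    simp only [Real.exp_le_one_iff]
    nlinarith
  simpa using h

theorem laplaceExponent_eq_neg_cgf (S : ℝ≥0 → Ω → ℝ) (P : Measure Ω) (lam : ℝ) :
    laplaceExponent S P lam = -cgf (S 1) P (-lam) := rfl

theorem IsSubordinator.laplaceExponent_nonneg (hS : IsSubordinator S P) {lam : ℝ}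
    (hlam : 0 ≤ lam) : 0 ≤ laplaceExponent S P lam := by
  rw [laplaceExponent_eq_neg_cgf]
  exact neg_nonneg.2 (hS.cgf_nonpos hlam 1)

/-- `E[exp (-lam S_t)] = exp (-t φ(lam))`. -/
theorem IsSubordinator.integral_exp (hS : IsSubordinator S P) {lam : ℝ} (hlam : 0 ≤ lam)
    (t : ℝ≥0) :
    ∫ ω, Real.exp (-lam * S t ω) ∂P = Real.exp (-laplaceExponent S P lam * t) := by
  have h := eq_mul_of_additive_of_nonneg (f := fun t => -cgf (S t) P (-lam))
    (fun s t => by rw [hS.cgf_add hlam]; ring)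
    (fun t => neg_nonneg.2 (hS.cgf_nonpos hlam t)) t
  rw [← laplaceExponent_eq_neg_cgf] at h
  have h2 := exp_cgf (X := S t) (μ := P) (hS.integrable_exp t hlam)
  rw [mgf] at h2
  rw [← h2]
  congr 1
  linarith

theorem IsSubordinator.mem_interior_integrableExpSet (hS : IsSubordinator S P) {v : ℝ}
    (hv : v < 0) : v ∈ interior (integrableExpSet (S 1) P) := by
  refine mem_interior.2 ⟨Iio 0, fun w hw => ?_, isOpen_Iio, hv⟩
  have := hS.integrable_exp 1 (lam := -w) (by simpa using (le_of_lt hw))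
  simpa [integrableExpSet] using this

theorem IsSubordinator.differentiableAt_laplaceExponent (hS : IsSubordinator S P) {lam : ℝ}
    (hlam : 0 < lam) : DifferentiableAt ℝ (laplaceExponent S P) lam := by
  have h := (analyticAt_cgf (hS.mem_interior_integrableExpSet (neg_lt_zero.2 hlam))).differentiableAt
  exact (h.comp lam differentiableAt_id.neg).neg

theorem IsSubordinator.deriv_laplaceExponent (hS : IsSubordinator S P) {lam : ℝ}
    (hlam : 0 < lam) : deriv (laplaceExponent S P) lam = deriv (cgf (S 1) P) (-lam) := by
  have h := (analyticAt_cgf (hS.mem_interior_integrableExpSet (neg_lt_zero.2 hlam))).differentiableAt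
  have h2 := (h.hasDerivAt.comp lam (hasDerivAt_neg lam)).neg
  have h3 : -(cgf (S 1) P ∘ Neg.neg) = laplaceExponent S P := rfl
  rw [h3] at h2
  simpa using h2.deriv

/-- The Laplace exponent is concave, because the cumulant generating function is convex. -/
theorem IsSubordinator.antitoneOn_deriv_laplaceExponent (hS : IsSubordinator S P) :
    AntitoneOn (deriv (laplaceExponent S P)) (Ioi 0) := by
  have han : AnalyticOnNhd ℝ (cgf (S 1) P) (Iio 0) := fun v hv =>
    analyticAt_cgf (hS.mem_interior_integrableExpSet hv)
  have hconv : ConvexOn ℝ (Iio 0) (cgf (S 1) P) := by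
    refine convexOn_of_deriv2_nonneg (convex_Iio 0) han.continuousOn ?_ ?_ ?_
    · rw [interior_Iio]; exact han.differentiableOn
    · rw [interior_Iio]; exact han.deriv.differentiableOn
    · rw [interior_Iio]
      intro v hv
      rw [← iteratedDeriv_eq_iterate, iteratedDeriv_two_cgf_eq_integral
        (hS.mem_interior_integrableExpSet hv)]
      exact div_nonneg (integral_nonneg fun ω => by positivity) mgf_nonneg
  have hmono := hconv.monotoneOn_deriv fun v hv => (han v hv).differentiableAt
  intro a ha b hb hab
  rw [hS.deriv_laplaceExponent ha, hS.deriv_laplaceExponent hb]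
  exact hmono (by simpa using hb) (by simpa using ha) (by simpa using hab)

theorem IsSubordinator.laplaceExponent_strictMonoOn (hS : IsSubordinator S P)
    (hd : ∀ lam, 0 < lam → 0 < deriv (laplaceExponent S P) lam) :
    StrictMonoOn (laplaceExponent S P) (Ioi 0) := by
  refine strictMonoOn_of_deriv_pos (convex_Ioi 0) (fun x hx =>
    (hS.differentiableAt_laplaceExponent hx).continuousAt.continuousWithinAt) fun x hx => ?_
  rw [interior_Ioi] at hx
  exact hd x hx

theorem IsSubordinator.laplaceExponent_pos (hS : IsSubordinator S P)
    (hd : ∀ lam, 0 < lam → 0 < deriv (laplaceExponent S P) lam) {lam : ℝ} (hlam : 0 < lam) :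
    0 < laplaceExponent S P lam :=
  (hS.laplaceExponent_nonneg (half_pos hlam).le).trans_lt
    (hS.laplaceExponent_strictMonoOn hd (half_pos hlam) hlam (half_lt_self hlam))

/-! ### The Laplace transform of the potential measure -/

theorem IsSubordinator.lintegral_potentialMeasure (hS : IsSubordinator S P) {f : ℝ → ℝ≥0∞}
    (hf : Measurable f) :
    ∫⁻ y, f y ∂(potentialMeasure S P)
      = ∫⁻ t in Ioi (0 : ℝ), ∫⁻ y, f y ∂(P.map (S t.toNNReal)) := by
  have h := hS.aemeasurable_uncurry
  rw [potentialMeasure, lintegral_map' hf.aemeasurable h]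
  refine (lintegral_prod_symm _ (hf.comp_aemeasurable h)).trans ?_
  refine lintegral_congr fun t => ?_
  rw [lintegral_map hf (hS.measurable _)]
  rfl

/-- The Laplace transform of the potential measure is `1 / φ`. -/
theorem IsSubordinator.lintegral_exp_potentialMeasure (hS : IsSubordinator S P) {lam : ℝ}
    (hlam : 0 < lam) (hpos : 0 < laplaceExponent S P lam) :
    ∫⁻ y, ENNReal.ofReal (Real.exp (-lam * y)) ∂(potentialMeasure S P)
      = ENNReal.ofReal (1 / laplaceExponent S P lam) := by
  rw [hS.lintegral_potentialMeasure (by fun_prop)]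
  have h1 : ∀ t ∈ Ioi (0 : ℝ),
      ∫⁻ y, ENNReal.ofReal (Real.exp (-lam * y)) ∂(P.map (S t.toNNReal))
        = ENNReal.ofReal (Real.exp (-laplaceExponent S P lam * t)) := by
    intro t ht
    rw [lintegral_map (by fun_prop) (hS.measurable _), ← ofReal_integral_eq_lintegral_ofReal
      (hS.integrable_exp _ hlam.le) (ae_of_all _ fun _ => (Real.exp_pos _).le),
      hS.integral_exp hlam.le, Real.coe_toNNReal _ (le_of_lt ht)]
  rw [setLIntegral_congr_fun measurableSet_Ioi h1, ← ofReal_integral_eq_lintegral_ofReal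
    (integrableOn_exp_mul_Ioi (neg_lt_zero.2 hpos) 0) (ae_of_all _ fun _ => (Real.exp_pos _).le),
    integral_exp_mul_Ioi (neg_lt_zero.2 hpos)]
  simp [neg_div_neg_eq]

/-- Differentiating the Laplace transform `1 / φ` of the potential measure. -/
theorem IsSubordinator.lintegral_mul_exp_potentialMeasure (hS : IsSubordinator S P)
    (hd : ∀ lam, 0 < lam → 0 < deriv (laplaceExponent S P) lam)
    (hU : ∀ᵐ y ∂(potentialMeasure S P), 0 ≤ y) {lam : ℝ} (hlam : 0 < lam) :
    ∫⁻ y, ENNReal.ofReal (y * Real.exp (-lam * y)) ∂(potentialMeasure S P)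
      = ENNReal.ofReal
        (deriv (laplaceExponent S P) lam / laplaceExponent S P lam ^ 2) := by
  set φ := laplaceExponent S P with hφ
  set U := potentialMeasure S P with hUdef
  have hφpos : ∀ {w : ℝ}, 0 < w → 0 < φ w := fun hw => hS.laplaceExponent_pos hd hw
  have hint : ∀ {w : ℝ}, 0 < w → Integrable (fun y => Real.exp (-w * y)) U := by
    intro w hw
    refine ⟨by fun_prop, ?_⟩
    rw [hasFiniteIntegral_iff_ofReal (ae_of_all _ fun _ => (Real.exp_pos _).le),
      hS.lintegral_exp_potentialMeasure hw (hφpos hw)]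
    exact ENNReal.ofReal_lt_top
  have hmem : -lam ∈ interior (integrableExpSet id U) := by
    refine mem_interior.2 ⟨Iio 0, fun w hw => ?_, isOpen_Iio, neg_lt_zero.2 hlam⟩
    have := hint (w := -w) (by simpa using hw)
    simpa [integrableExpSet] using this
  have hmgf : ∀ w ∈ Ioi (0 : ℝ), mgf id U (-w) = 1 / φ w := by
    intro w hw
    rw [mgf, integral_eq_lintegral_of_nonneg_ae (ae_of_all _ fun _ => (Real.exp_pos _).le)
      (by fun_prop)]
    simp only [id]
    rw [hS.lintegral_exp_potentialMeasure hw (hφpos hw),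
      ENNReal.toReal_ofReal (one_div_pos.2 (hφpos hw)).le]
  have h1 := ((hasDerivAt_mgf hmem).comp lam (hasDerivAt_neg lam)).neg
  have h2 := ((hS.differentiableAt_laplaceExponent hlam).hasDerivAt.inv (hφpos hlam).ne').neg
  have h3 : -(mgf id U ∘ Neg.neg) =ᶠ[𝓝 lam] -(φ⁻¹) := by
    filter_upwards [Ioi_mem_nhds hlam] with w hw
    simp [hmgf w hw]
  have h4 := (h2.congr_of_eventuallyEq h3).unique h1
  have h5 : ∫ y, y * Real.exp (-lam * y) ∂U = deriv φ lam / φ lam ^ 2 := by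
    simp only [id] at h4
    rw [hφ]
    linarith [h4, neg_div (laplaceExponent S P lam ^ 2) (deriv (laplaceExponent S P) lam)]
  rw [← h5, ofReal_integral_eq_lintegral_ofReal]
  · simpa using integrable_pow_mul_exp_of_mem_interior_integrableExpSet hmem 1
  · filter_upwards [hU] with y hy
    positivity

/-! ### Bounds on a decreasing density by its Laplace transform -/

section DecreasingDensity

variable {u F : ℝ → ℝ}

theorem lintegral_decreasing_density (hu : AntitoneOn u (Ioi 0)) {f : ℝ → ℝ≥0∞}
    (hf : Measurable f) :
    ∫⁻ t, f t ∂((volume.restrict (Ioi 0)).withDensity fun t => ENNReal.ofReal (u t))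
      = ∫⁻ t in Ioi 0, ENNReal.ofReal (u t) * f t := by
  rw [lintegral_withDensity_eq_lintegral_mul₀
    (aemeasurable_restrict_of_antitoneOn measurableSet_Ioi hu).ennreal_ofReal hf.aemeasurable]
  rfl

theorem antitoneOn_of_laplace (hF0 : ∀ lam, 0 < lam → 0 ≤ F lam)
    (hF : ∀ lam, 0 < lam → ∫⁻ t in Ioi 0, ENNReal.ofReal (u t) *
      ENNReal.ofReal (t * Real.exp (-lam * t)) = ENNReal.ofReal (F lam)) :
    AntitoneOn F (Ioi 0) := by
  intro a ha b hb hab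
  rw [← ENNReal.ofReal_le_ofReal_iff (hF0 a ha), ← hF a ha, ← hF b hb]
  refine setLIntegral_mono' measurableSet_Ioi fun t (ht : 0 < t) => ?_
  gcongr

theorem lintegral_Ioc_density_mul_le
    (hF : ∀ lam, 0 < lam → ∫⁻ t in Ioi 0, ENNReal.ofReal (u t) *
      ENNReal.ofReal (t * Real.exp (-lam * t)) = ENNReal.ofReal (F lam)) {a : ℝ} (ha : 0 < a) :
    ∫⁻ t in Ioc 0 a, ENNReal.ofReal (u t) * ENNReal.ofReal t
      ≤ ENNReal.ofReal (Real.exp 1 * F a⁻¹) := by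
  rw [ENNReal.ofReal_mul (Real.exp_pos _).le, ← hF _ (inv_pos.2 ha),
    ← lintegral_const_mul' _ _ ENNReal.ofReal_ne_top]
  refine (setLIntegral_mono' measurableSet_Ioc fun t ht => ?_).trans
    (lintegral_mono_set Ioc_subset_Ioi_self)
  rw [mul_left_comm, ← ENNReal.ofReal_mul (Real.exp_pos _).le]
  gcongr
  have h1 : a⁻¹ * t ≤ 1 := by rw [inv_mul_le_iff₀ ha, mul_one]; exact ht.2
  have h2 : 1 ≤ Real.exp 1 * Real.exp (-a⁻¹ * t) := by
    rw [← Real.exp_add]; exact Real.one_le_exp (by linarith)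
  nlinarith [ht.1]

/-- The upper bound `u a ≤ 2 e a⁻² F(a⁻¹)`, a constant multiple of the value suggested by scaling; it
uses only monotonicity, since `u t ≥ u a` on `(0, a]`. -/
theorem density_mul_sq_le (hu : AntitoneOn u (Ioi 0)) (hu0 : ∀ t ∈ Ioi (0 : ℝ), 0 ≤ u t)
    (hF0 : ∀ lam, 0 < lam → 0 ≤ F lam)
    (hF : ∀ lam, 0 < lam → ∫⁻ t in Ioi 0, ENNReal.ofReal (u t) *
      ENNReal.ofReal (t * Real.exp (-lam * t)) = ENNReal.ofReal (F lam)) {a : ℝ} (ha : 0 < a) :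
    u a * a ^ 2 ≤ 2 * Real.exp 1 * F a⁻¹ := by
  have h1 : ENNReal.ofReal (u a * (a ^ 2 / 2))
      ≤ ∫⁻ t in Ioc 0 a, ENNReal.ofReal (u t) * ENNReal.ofReal t := by
    have h2 : ∫⁻ t in Ioc 0 a, ENNReal.ofReal t = ENNReal.ofReal (a ^ 2 / 2) := by
      rw [← ofReal_integral_eq_lintegral_ofReal, ← intervalIntegral.integral_of_le ha.le,
        integral_id]
      · simp
      · exact (continuous_id.integrableOn_Icc (μ := volume)).mono_set Ioc_subset_Icc_self
      · exact (ae_restrict_mem measurableSet_Ioc).mono fun t ht => ht.1.le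
    rw [ENNReal.ofReal_mul (hu0 a ha), ← h2, ← lintegral_const_mul' _ _ ENNReal.ofReal_ne_top]
    refine setLIntegral_mono' measurableSet_Ioc fun t ht => ?_
    gcongr
    exact hu ht.1 ha ht.2
  have h3 := h1.trans (lintegral_Ioc_density_mul_le hF ha)
  rw [ENNReal.ofReal_le_ofReal_iff (mul_nonneg (Real.exp_pos _).le (hF0 _ (inv_pos.2 ha)))] at h3
  linarith

/-- The part of the Laplace integral over `(0, b]` is at most `e * F b⁻¹`; on `(b, ∞)` the density
is at most `u b`. -/
theorem laplace_le_add_density (hu : AntitoneOn u (Ioi 0)) (hu0 : ∀ t ∈ Ioi (0 : ℝ), 0 ≤ u t)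
    (hF0 : ∀ lam, 0 < lam → 0 ≤ F lam)
    (hF : ∀ lam, 0 < lam → ∫⁻ t in Ioi 0, ENNReal.ofReal (u t) *
      ENNReal.ofReal (t * Real.exp (-lam * t)) = ENNReal.ofReal (F lam)) {lam b : ℝ}
    (hlam : 0 < lam) (hb : 0 < b) :
    F lam ≤ Real.exp 1 * F b⁻¹ + u b * (4 / lam ^ 2) := by
  have hnear : ∫⁻ t in Ioc 0 b, ENNReal.ofReal (u t) * ENNReal.ofReal (t * Real.exp (-lam * t))
      ≤ ENNReal.ofReal (Real.exp 1 * F b⁻¹) := by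
    refine (setLIntegral_mono' measurableSet_Ioc fun t ht => ?_).trans
      (lintegral_Ioc_density_mul_le hF hb)
    gcongr
    exact mul_le_of_le_one_right ht.1.le (Real.exp_le_one_iff.2 (by nlinarith [ht.1]))
  have hfar : ∫⁻ t in Ioi b, ENNReal.ofReal (u t) * ENNReal.ofReal (t * Real.exp (-lam * t))
      ≤ ENNReal.ofReal (u b * (4 / lam ^ 2)) := by
    have h1 : ∫⁻ t in Ioi (0 : ℝ), ENNReal.ofReal (2 / lam * Real.exp (-(lam / 2) * t))
        = ENNReal.ofReal (4 / lam ^ 2) := by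
      rw [← ofReal_integral_eq_lintegral_ofReal
        ((integrableOn_exp_mul_Ioi (neg_lt_zero.2 (half_pos hlam)) 0).const_mul _)
        (ae_of_all _ fun _ => by positivity), integral_const_mul,
        integral_exp_mul_Ioi (neg_lt_zero.2 (half_pos hlam))]
      congr 1
      simp only [mul_zero, Real.exp_zero]
      field_simp
      norm_num
    rw [ENNReal.ofReal_mul (hu0 b hb), ← h1, ← lintegral_const_mul' _ _ ENNReal.ofReal_ne_top]
    refine (setLIntegral_mono' measurableSet_Ioi fun t ht => ?_).trans
      (lintegral_mono_set (Ioi_subset_Ioi hb.le))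
    have ht0 : 0 < t := hb.trans ht
    refine mul_le_mul' (ENNReal.ofReal_le_ofReal (hu hb ht0 (le_of_lt ht)))
      (ENNReal.ofReal_le_ofReal ?_)
    -- `lam * t / 2 ≤ exp (lam * t / 2)` absorbs the factor `t`
    have h2 : lam * t / 2 ≤ Real.exp (lam * t / 2) := by
      linarith [Real.add_one_le_exp (lam * t / 2)]
    have h3 : Real.exp (-(lam / 2) * t) = Real.exp (lam * t / 2) * Real.exp (-lam * t) := by
      rw [← Real.exp_add]; congr 1; ring
    rw [h3, ← mul_assoc]
    refine mul_le_mul_of_nonneg_right ?_ (Real.exp_pos _).le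
    rw [div_mul_eq_mul_div, le_div_iff₀ hlam]
    linarith
  have h := hF lam hlam
  rw [← Ioc_union_Ioi_eq_Ioi hb.le, lintegral_union measurableSet_Ioi
    (Ioc_disjoint_Ioi_same)] at h
  have h4 := h.symm.le.trans (add_le_add hnear hfar)
  have h5 : 0 ≤ Real.exp 1 * F b⁻¹ := mul_nonneg (Real.exp_pos _).le (hF0 _ (inv_pos.2 hb))
  have h6 : 0 ≤ u b * (4 / lam ^ 2) := mul_nonneg (hu0 b hb) (by positivity)
  rwa [← ENNReal.ofReal_add h5 h6, ENNReal.ofReal_le_ofReal_iff (add_nonneg h5 h6)] at h4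

/-- If `F` decays geometrically along doublings, then the density is bounded below by its Laplace
transform near zero. -/
theorem exists_le_density_mul_sq (hu : AntitoneOn u (Ioi 0)) (hu0 : ∀ t ∈ Ioi (0 : ℝ), 0 ≤ u t)
    (hF0 : ∀ lam, 0 < lam → 0 ≤ F lam)
    (hF : ∀ lam, 0 < lam → ∫⁻ t in Ioi 0, ENNReal.ofReal (u t) *
      ENNReal.ofReal (t * Real.exp (-lam * t)) = ENNReal.ofReal (F lam))
    {q : ℝ} (hq0 : 0 ≤ q) (hq1 : q < 1) (hq : ∀ᶠ w in atTop, F (2 * w) ≤ q * F w) :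
    ∃ c > 0, ∀ᶠ w in atTop, c * F w ≤ u w⁻¹ * (w⁻¹) ^ 2 := by
  obtain ⟨n, hn⟩ : ∃ n : ℕ, q ^ n < 1 / (2 * Real.exp 1) :=
    exists_pow_lt_of_lt_one (by positivity) hq1
  have hiter : ∀ k : ℕ, ∀ᶠ w in atTop, F (2 ^ k * w) ≤ q ^ k * F w := by
    intro k
    induction k with
    | zero => simp
    | succ k ih =>
      have h2 : Tendsto (fun w : ℝ => 2 * w) atTop atTop :=
        tendsto_id.const_mul_atTop two_pos
      filter_upwards [hq, h2.eventually ih] with w h3 h4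
      calc F (2 ^ (k + 1) * w) = F (2 ^ k * (2 * w)) := by ring_nf
        _ ≤ q ^ k * F (2 * w) := h4
        _ ≤ q ^ k * (q * F w) := by gcongr
        _ = q ^ (k + 1) * F w := by ring
  refine ⟨1 / (8 * (2 ^ n) ^ 2), by positivity, ?_⟩
  have hdiv : Tendsto (fun w : ℝ => w / 2 ^ n) atTop atTop :=
    tendsto_id.atTop_div_const (by positivity)
  filter_upwards [hdiv.eventually (hiter n), eventually_gt_atTop 0] with w hw hw0
  have hlam : 0 < w / 2 ^ n := by positivity
  have h1 := laplace_le_add_density hu hu0 hF0 hF hlam (inv_pos.2 hw0)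
  have h2 : F w ≤ F (w / 2 ^ n) := antitoneOn_of_laplace hF0 hF hlam hw0
    (div_le_self hw0.le (one_le_pow₀ one_le_two))
  rw [mul_div_cancel₀ _ (by positivity)] at hw
  rw [inv_inv] at h1
  have h3 : Real.exp 1 * F w ≤ F (w / 2 ^ n) / 2 := by
    calc Real.exp 1 * F w ≤ Real.exp 1 * (1 / (2 * Real.exp 1) * F (w / 2 ^ n)) := by
          have := hF0 _ hlam
          gcongr
          exact hw.trans (by gcongr)
      _ = F (w / 2 ^ n) / 2 := by field_simp
  have h4 : F w ≤ 2 * (u w⁻¹ * (4 / (w / 2 ^ n) ^ 2)) := by linarith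
  calc 1 / (8 * (2 ^ n) ^ 2) * F w
      ≤ 1 / (8 * (2 ^ n) ^ 2) * (2 * (u w⁻¹ * (4 / (w / 2 ^ n) ^ 2))) := by gcongr
    _ = u w⁻¹ * (w⁻¹) ^ 2 := by field_simp; ring

end DecreasingDensity

/-! ### The Gaussian potential of a decreasing density -/

/-- For fixed `t` the kernel decays faster than any power of `r² / t`, so on `t ≤ r²` it is
dominated by a multiple of `t`. -/
theorem gaussKernel_le_mul {d : ℕ} (hd : 2 ≤ d) {t r : ℝ} (ht : 0 < t) (hr : 0 < r)
    (htr : t ≤ r ^ 2) :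
    gaussKernel d t r ≤ 4 ^ d * (d.factorial : ℝ) * r ^ (-(d : ℝ) - 2) * t := by
  have hd' : (2 : ℝ) ≤ d := by exact_mod_cast hd
  have hx : 1 ≤ r ^ 2 / t := (one_le_div ht).2 htr
  have h1 : (4 * Real.pi * t) ^ (-(d : ℝ) / 2) ≤ t ^ (-(d : ℝ) / 2) := by
    refine Real.rpow_le_rpow_of_nonpos ht ?_ (by linarith)
    nlinarith [Real.pi_gt_three]
  have h2 : t ^ (-(d : ℝ) / 2)
      = (r ^ 2 / t) ^ ((d : ℝ) / 2 + 1) * (r ^ (-(d : ℝ) - 2) * t) := by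
    rw [Real.div_rpow (by positivity) ht.le, ← Real.rpow_natCast r 2, ← Real.rpow_mul hr.le,
      show (-(d : ℝ) - 2) = -(((2 : ℕ) : ℝ) * ((d : ℝ) / 2 + 1)) by push_cast; ring,
      Real.rpow_neg hr.le, show -(d : ℝ) / 2 = -((d : ℝ) / 2 + 1) + 1 by ring,
      Real.rpow_add_one ht.ne', Real.rpow_neg ht.le]
    field_simp
  have h3 : (r ^ 2 / t) ^ ((d : ℝ) / 2 + 1) ≤ (r ^ 2 / t) ^ d := by
    rw [← Real.rpow_natCast (r ^ 2 / t) d]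
    exact Real.rpow_le_rpow_of_exponent_le hx (by linarith)
  have h4 : (r ^ 2 / t) ^ d ≤ 4 ^ d * (d.factorial : ℝ) * Real.exp (r ^ 2 / (4 * t)) := by
    have := Real.pow_div_factorial_le_exp (r ^ 2 / (4 * t)) (by positivity) d
    rw [div_le_iff₀ (by positivity)] at this
    calc (r ^ 2 / t) ^ d = 4 ^ d * (r ^ 2 / (4 * t)) ^ d := by
          rw [← mul_pow]; congr 1; field_simp
      _ ≤ 4 ^ d * (Real.exp (r ^ 2 / (4 * t)) * d.factorial) := by gcongr
      _ = _ := by ring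
  have h5 : Real.exp (r ^ 2 / (4 * t)) * Real.exp (-r ^ 2 / (4 * t)) = 1 := by
    rw [← Real.exp_add, neg_div, add_neg_cancel, Real.exp_zero]
  calc gaussKernel d t r
      ≤ t ^ (-(d : ℝ) / 2) * Real.exp (-r ^ 2 / (4 * t)) := by
        unfold gaussKernel; gcongr
    _ ≤ (4 ^ d * (d.factorial : ℝ) * Real.exp (r ^ 2 / (4 * t)) * (r ^ (-(d : ℝ) - 2) * t))
        * Real.exp (-r ^ 2 / (4 * t)) := by
        rw [h2]
        have := h3.trans h4
        gcongr
    _ = 4 ^ d * (d.factorial : ℝ) * r ^ (-(d : ℝ) - 2) * t *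
        (Real.exp (r ^ 2 / (4 * t)) * Real.exp (-r ^ 2 / (4 * t))) := by ring
    _ = _ := by rw [h5, mul_one]

theorem gaussKernel_nonneg (d : ℕ) {t : ℝ} (ht : 0 ≤ t) (r : ℝ) : 0 ≤ gaussKernel d t r := by
  unfold gaussKernel
  positivity

theorem gaussKernel_le_rpow (d : ℕ) {t : ℝ} (ht : 0 < t) (r : ℝ) :
    gaussKernel d t r ≤ t ^ (-(d : ℝ) / 2) := by
  have h1 : (4 * Real.pi * t) ^ (-(d : ℝ) / 2) ≤ t ^ (-(d : ℝ) / 2) := by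
    refine Real.rpow_le_rpow_of_nonpos ht ?_ (by linarith [Nat.cast_nonneg (α := ℝ) d])
    nlinarith [Real.pi_gt_three]
  refine (mul_le_of_le_one_right (by positivity) (Real.exp_le_one_iff.2 ?_)).trans h1
  exact div_nonpos_of_nonpos_of_nonneg (by nlinarith [sq_nonneg r]) (by positivity)

theorem measurable_gaussKernel (d : ℕ) (r : ℝ) : Measurable fun t => gaussKernel d t r := by
  unfold gaussKernel
  fun_prop

theorem sq_rpow_eq {r : ℝ} (hr : 0 < r) (p : ℝ) : (r ^ 2) ^ p = r ^ (2 * p) := by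
  rw [← Real.rpow_natCast r 2, ← Real.rpow_mul hr.le]
  norm_num

section GaussPotential

variable {u F : ℝ → ℝ} {d : ℕ}

/-- On `(0, r²]` the kernel is dominated by a multiple of `t`, whose integral against the density is
controlled by `F`; on `(r², ∞)` the density is at most `u (r ^ 2)` and the kernel is integrable
because `d ≥ 3`. -/
theorem lintegral_gaussKernel_le (hd : 3 ≤ d) (hu : AntitoneOn u (Ioi 0))
    (hu0 : ∀ t ∈ Ioi (0 : ℝ), 0 ≤ u t) (hF0 : ∀ lam, 0 < lam → 0 ≤ F lam)
    (hF : ∀ lam, 0 < lam → ∫⁻ t in Ioi 0, ENNReal.ofReal (u t) *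
      ENNReal.ofReal (t * Real.exp (-lam * t)) = ENNReal.ofReal (F lam)) {r : ℝ} (hr : 0 < r) :
    ∫⁻ t in Ioi 0, ENNReal.ofReal (u t) * ENNReal.ofReal (gaussKernel d t r)
      ≤ ENNReal.ofReal ((4 ^ d * (d.factorial : ℝ) + 4) * Real.exp 1 *
        (r ^ (-(d : ℝ) - 2) * F (r ^ 2)⁻¹)) := by
  have hd' : (3 : ℝ) ≤ d := by exact_mod_cast hd
  have ha : 0 < r ^ 2 := by positivity
  have hFa := hF0 _ (inv_pos.2 ha)
  have hnear : ∫⁻ t in Ioc 0 (r ^ 2), ENNReal.ofReal (u t) * ENNReal.ofReal (gaussKernel d t r)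
      ≤ ENNReal.ofReal (4 ^ d * (d.factorial : ℝ) * r ^ (-(d : ℝ) - 2) *
        (Real.exp 1 * F (r ^ 2)⁻¹)) := by
    rw [ENNReal.ofReal_mul (by positivity)]
    refine le_trans ?_ (mul_le_mul_right (lintegral_Ioc_density_mul_le hF ha) _)
    rw [← lintegral_const_mul' _ _ ENNReal.ofReal_ne_top]
    refine setLIntegral_mono' measurableSet_Ioc fun t ht => ?_
    rw [mul_left_comm, ← ENNReal.ofReal_mul
      (show 0 ≤ 4 ^ d * (d.factorial : ℝ) * r ^ (-(d : ℝ) - 2) by positivity)]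
    gcongr
    exact gaussKernel_le_mul (by omega) ht.1 hr ht.2
  have hfar : ∫⁻ t in Ioi (r ^ 2), ENNReal.ofReal (u t) * ENNReal.ofReal (gaussKernel d t r)
      ≤ ENNReal.ofReal (4 * Real.exp 1 * (r ^ (-(d : ℝ) - 2) * F (r ^ 2)⁻¹)) := by
    have hexp : -(d : ℝ) / 2 < -1 := by linarith
    have h1 : ∫⁻ t in Ioi (r ^ 2), ENNReal.ofReal (t ^ (-(d : ℝ) / 2))
        = ENNReal.ofReal (-(r ^ 2) ^ (-(d : ℝ) / 2 + 1) / (-(d : ℝ) / 2 + 1)) := by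
      rw [← ofReal_integral_eq_lintegral_ofReal (integrableOn_Ioi_rpow_of_lt hexp ha),
        integral_Ioi_rpow_of_lt hexp ha]
      exact (ae_restrict_mem measurableSet_Ioi).mono fun t ht =>
        Real.rpow_nonneg (ha.trans ht).le _
    have h2 : ∫⁻ t in Ioi (r ^ 2), ENNReal.ofReal (u t) * ENNReal.ofReal (gaussKernel d t r)
        ≤ ENNReal.ofReal (u (r ^ 2) *
          (-(r ^ 2) ^ (-(d : ℝ) / 2 + 1) / (-(d : ℝ) / 2 + 1))) := by
      rw [ENNReal.ofReal_mul (hu0 _ ha), ← h1, ← lintegral_const_mul' _ _ ENNReal.ofReal_ne_top]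
      refine setLIntegral_mono' measurableSet_Ioi fun t ht => ?_
      gcongr
      · exact hu ha (ha.trans ht) (le_of_lt ht)
      · exact gaussKernel_le_rpow d (ha.trans ht) r
    refine h2.trans (ENNReal.ofReal_le_ofReal ?_)
    -- `d ≥ 3` makes the exponent `1 - d / 2` at most `-1 / 2`
    have h3 : -(r ^ 2) ^ (-(d : ℝ) / 2 + 1) / (-(d : ℝ) / 2 + 1)
        ≤ 2 * (r ^ 2) ^ (-(d : ℝ) / 2 + 1) := by
      rw [div_le_iff_of_neg (by linarith)]
      nlinarith [Real.rpow_pos_of_pos ha (-(d : ℝ) / 2 + 1)]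
    have h4 : (r ^ 2) ^ (-(d : ℝ) / 2 + 1) = r ^ (-(d : ℝ) - 2) * (r ^ 2) ^ 2 := by
      rw [sq_rpow_eq hr, ← pow_mul, ← Real.rpow_natCast r (2 * 2), ← Real.rpow_add hr]
      congr 1; push_cast; ring
    calc u (r ^ 2) * (-(r ^ 2) ^ (-(d : ℝ) / 2 + 1) / (-(d : ℝ) / 2 + 1))
        ≤ u (r ^ 2) * (2 * (r ^ 2) ^ (-(d : ℝ) / 2 + 1)) :=
          mul_le_mul_of_nonneg_left h3 (hu0 _ ha)
      _ = 2 * r ^ (-(d : ℝ) - 2) * (u (r ^ 2) * (r ^ 2) ^ 2) := by rw [h4]; ring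
      _ ≤ 2 * r ^ (-(d : ℝ) - 2) * (2 * Real.exp 1 * F (r ^ 2)⁻¹) := by
          exact mul_le_mul_of_nonneg_left (density_mul_sq_le hu hu0 hF0 hF ha) (by positivity)
      _ = _ := by ring
  rw [← Ioc_union_Ioi_eq_Ioi ha.le, lintegral_union measurableSet_Ioi Ioc_disjoint_Ioi_same]
  refine (add_le_add hnear hfar).trans ?_
  rw [← ENNReal.ofReal_add (by positivity) (by positivity)]
  exact ENNReal.ofReal_le_ofReal (le_of_eq (by ring))

/-- The part of the integral over `(r² / 2, r²]`, where the kernel is comparable to `r ^ (-d)`. -/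
theorem le_lintegral_gaussKernel (d : ℕ) (hu : AntitoneOn u (Ioi 0))
    (hu0 : ∀ t ∈ Ioi (0 : ℝ), 0 ≤ u t) {r : ℝ} (hr : 0 < r) :
    ENNReal.ofReal ((4 * Real.pi) ^ (-(d : ℝ) / 2) * Real.exp (-1 / 2) / 2 *
        (r ^ (-(d : ℝ) - 2) * (u (r ^ 2) * (r ^ 2) ^ 2)))
      ≤ ∫⁻ t in Ioi 0, ENNReal.ofReal (u t) * ENNReal.ofReal (gaussKernel d t r) := by
  have ha : 0 < r ^ 2 := by positivity
  have hsub : Ioc (r ^ 2 / 2) (r ^ 2) ⊆ Ioi 0 := fun t ht => (half_pos ha).trans ht.1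
  refine le_trans ?_ (lintegral_mono_set hsub)
  have hk : ∀ t ∈ Ioc (r ^ 2 / 2) (r ^ 2),
      (4 * Real.pi * r ^ 2) ^ (-(d : ℝ) / 2) * Real.exp (-1 / 2) ≤ gaussKernel d t r := by
    intro t ht
    have ht0 : 0 < t := hsub ht
    have h1 : (4 * Real.pi * r ^ 2) ^ (-(d : ℝ) / 2) ≤ (4 * Real.pi * t) ^ (-(d : ℝ) / 2) := by
      refine Real.rpow_le_rpow_of_nonpos (by positivity) ?_
        (by linarith [Nat.cast_nonneg (α := ℝ) d])
      have := ht.2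
      gcongr
    have h2 : -1 / 2 ≤ -r ^ 2 / (4 * t) := by
      rw [le_div_iff₀ (by positivity)]
      linarith [ht.1]
    unfold gaussKernel
    gcongr
  have h3 : ENNReal.ofReal (u (r ^ 2) *
      ((4 * Real.pi * r ^ 2) ^ (-(d : ℝ) / 2) * Real.exp (-1 / 2)) * (r ^ 2 / 2))
      ≤ ∫⁻ t in Ioc (r ^ 2 / 2) (r ^ 2),
        ENNReal.ofReal (u t) * ENNReal.ofReal (gaussKernel d t r) := by
    have h4 : volume (Ioc (r ^ 2 / 2) (r ^ 2)) = ENNReal.ofReal (r ^ 2 / 2) := by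
      rw [Real.volume_Ioc]; congr 1; ring
    rw [ENNReal.ofReal_mul (mul_nonneg (hu0 _ ha) (by positivity)), ← h4, ← setLIntegral_const]
    refine setLIntegral_mono' measurableSet_Ioc fun t ht => ?_
    rw [ENNReal.ofReal_mul (hu0 _ ha)]
    gcongr
    · exact hu (hsub ht) ha ht.2
    · exact hk t ht
  refine le_trans (le_of_eq ?_) h3
  congr 1
  have h5 : r ^ (-(d : ℝ) - 2) * (r ^ 2) ^ 2 = (r ^ 2) ^ (-(d : ℝ) / 2) * r ^ 2 := by
    rw [sq_rpow_eq hr, ← pow_mul, ← Real.rpow_natCast r (2 * 2), ← Real.rpow_natCast r 2,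
      ← Real.rpow_add hr, ← Real.rpow_add hr]
    congr 1; push_cast; ring
  rw [Real.mul_rpow (by positivity) ha.le]
  linear_combination ((4 * Real.pi) ^ (-(d : ℝ) / 2) * Real.exp (-1 / 2) / 2 * u (r ^ 2)) * h5

end GaussPotential

/-! ### Regular variation of the derivative of the Laplace exponent -/

section RegularVariation

variable {φ : ℝ → ℝ}

theorem exists_deriv_doubling_le {ρ : ℝ} (hρ : ρ < 0) (hφ : RegularlyVarying (deriv φ) ρ) :
    ∃ q, 0 ≤ q ∧ q < 1 ∧ ∀ᶠ w in atTop, deriv φ (2 * w) ≤ q * deriv φ w := by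
  have h1 : (2 : ℝ) ^ ρ < 1 := Real.rpow_lt_one_of_one_lt_of_neg one_lt_two hρ
  obtain ⟨q, hq1, hq2⟩ := exists_between h1
  refine ⟨q, (Real.rpow_nonneg two_pos.le ρ).trans hq1.le, hq2, ?_⟩
  filter_upwards [(hφ.2 2 two_pos).eventually_lt_const hq1, eventually_gt_atTop 0] with w hw hw0
  rw [div_lt_iff₀ (hφ.1 w hw0)] at hw
  rw [mul_comm 2 w]
  exact hw.le

/-- The mean value theorem for a function with decreasing derivative. -/
theorem deriv_mul_le_sub (hdiff : ∀ w, 0 < w → DifferentiableAt ℝ φ w)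
    (hanti : AntitoneOn (deriv φ) (Ioi 0)) {a b : ℝ} (ha : 0 < a) (hab : a < b) :
    deriv φ b * (b - a) ≤ φ b - φ a ∧ φ b - φ a ≤ deriv φ a * (b - a) := by
  obtain ⟨c, hc, h⟩ := exists_deriv_eq_slope φ hab
    (fun x hx => (hdiff x (ha.trans_le hx.1)).continuousAt.continuousWithinAt)
    (fun x hx => (hdiff x (ha.trans hx.1)).differentiableWithinAt)
  have hc0 : 0 < c := ha.trans hc.1
  rw [eq_div_iff (sub_pos.2 hab).ne'] at h
  rw [← h]
  have hba := (sub_pos.2 hab).le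
  exact ⟨mul_le_mul_of_nonneg_right (hanti hc0 (ha.trans hab) hc.2.le) hba,
    mul_le_mul_of_nonneg_right (hanti ha hc0 hc.1.le) hba⟩

/-- A nonnegative concave function satisfies `w φ'(w) ≤ φ(w)`. -/
theorem mul_deriv_le (hdiff : ∀ w, 0 < w → DifferentiableAt ℝ φ w)
    (hanti : AntitoneOn (deriv φ) (Ioi 0)) (hpos : ∀ w, 0 < w → 0 ≤ φ w) {w : ℝ} (hw : 0 < w) :
    w * deriv φ w ≤ φ w := by
  have h : ∀ ε ∈ Ioo 0 w, deriv φ w * (w - ε) ≤ φ w := fun ε hε => by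
    linarith [(deriv_mul_le_sub hdiff hanti hε.1 hε.2).1, hpos ε hε.1]
  have hlim : Tendsto (fun ε => deriv φ w * (w - ε)) (𝓝[>] 0) (𝓝 (deriv φ w * (w - 0))) :=
    ((continuous_const.mul (continuous_const.sub continuous_id)).tendsto 0).mono_left
      nhdsWithin_le_nhds
  rw [sub_zero, mul_comm] at hlim
  exact le_of_tendsto hlim (eventually_of_mem (Ioo_mem_nhdsGT hw) h)

/-- The part of Karamata's theorem needed when `φ'` is slowly varying: `φ(w)` is at most a multiple
of `w φ'(w)`. The bound propagates from `w` to `2 w` because `φ(2w) ≤ φ(w) + w φ'(w)` and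
`4 φ'(2w) ≥ 3 φ'(w)`; the latter inequality is recorded as well. -/
theorem exists_le_mul_deriv (hφ : RegularlyVarying (deriv φ) 0)
    (hdiff : ∀ w, 0 < w → DifferentiableAt ℝ φ w)
    (hanti : AntitoneOn (deriv φ) (Ioi 0)) (hmono : MonotoneOn φ (Ioi 0)) :
    ∃ C > 0, ∀ᶠ w in atTop, φ w ≤ C * (w * deriv φ w) ∧ deriv φ w * (3 / 4) ≤ deriv φ (2 * w) := by
  have hev : ∀ᶠ w in atTop, deriv φ w * (3 / 4) ≤ deriv φ (2 * w) := by
    have h1 := hφ.2 2 two_pos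
    rw [Real.rpow_zero] at h1
    filter_upwards [h1.eventually_const_lt (show (3 / 4 : ℝ) < 1 by norm_num),
      eventually_gt_atTop 0] with w hw hw0
    rw [lt_div_iff₀ (hφ.1 w hw0)] at hw
    rw [mul_comm 2 w]
    linarith
  obtain ⟨w₁, hw₁⟩ := eventually_atTop.1 hev
  set w₀ := max w₁ 1 with hw₀def
  have hw₀ : 0 < w₀ := one_pos.trans_le (le_max_right _ _)
  have hderiv : ∀ w, w₀ ≤ w → deriv φ w * (3 / 4) ≤ deriv φ (2 * w) := fun w hw =>
    hw₁ w ((le_max_left _ _).trans hw)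
  have hm : 0 < w₀ * deriv φ (2 * w₀) := mul_pos hw₀ (hφ.1 _ (by positivity))
  set C := max 2 (φ (2 * w₀) / (w₀ * deriv φ (2 * w₀))) with hC
  have hC2 : 2 ≤ C := le_max_left _ _
  have key : ∀ n : ℕ, ∀ w, w₀ ≤ w → w ≤ 2 ^ (n + 1) * w₀ → φ w ≤ C * (w * deriv φ w) := by
    intro n
    induction n with
    | zero =>
      intro w h1 h2
      rw [zero_add, pow_one] at h2
      have hw : 0 < w := hw₀.trans_le h1
      calc φ w ≤ φ (2 * w₀) := hmono hw (show (0 : ℝ) < 2 * w₀ by positivity) h2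
        _ = φ (2 * w₀) / (w₀ * deriv φ (2 * w₀)) * (w₀ * deriv φ (2 * w₀)) := by
            rw [div_mul_cancel₀ _ hm.ne']
        _ ≤ C * (w * deriv φ w) := by
            have := hanti hw (show (0 : ℝ) < 2 * w₀ by positivity) h2
            have hd0 := (hφ.1 (2 * w₀) (by positivity)).le
            gcongr
            exact le_max_right _ _
    | succ n ih =>
      intro w h1 h2
      rcases le_total w (2 ^ (n + 1) * w₀) with h3 | h3
      · exact ih w h1 h3
      · have h4 : w₀ ≤ w / 2 := by
          have : (2 : ℝ) ≤ 2 ^ (n + 1) := by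
            rw [pow_succ]; linarith [one_le_pow₀ (M₀ := ℝ) one_le_two (n := n)]
          nlinarith
        have h5 : 0 < w / 2 := hw₀.trans_le h4
        have h6 := ih (w / 2) h4 (by rw [pow_succ] at h2; linarith)
        have h7 := (deriv_mul_le_sub hdiff hanti h5 (show w / 2 < w by linarith)).2
        have h8 := hderiv _ h4
        rw [mul_div_cancel₀ _ two_ne_zero] at h8
        have h9 : 0 ≤ w / 2 * deriv φ (w / 2) := mul_nonneg h5.le (hφ.1 _ h5).le
        have h10 : w / 2 * (deriv φ (w / 2) * (3 / 4)) ≤ w / 2 * deriv φ w := by gcongr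
        calc φ w ≤ (C + 1) * (w / 2 * deriv φ (w / 2)) := by linarith
          _ ≤ C * (3 / 2 * (w / 2 * deriv φ (w / 2))) := by nlinarith
          _ ≤ C * (w * deriv φ w) := mul_le_mul_of_nonneg_left (by linarith) (by linarith)
  refine ⟨C, by linarith, ?_⟩
  filter_upwards [eventually_ge_atTop w₀] with w hw
  refine ⟨?_, hderiv w hw⟩
  obtain ⟨n, hn⟩ := pow_unbounded_of_one_lt (w / w₀) one_lt_two
  refine key n w hw ?_
  rw [div_lt_iff₀ hw₀] at hn
  refine hn.le.trans ?_
  gcongr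
  · exact one_le_two
  · exact Nat.le_succ n

/-- If the index `ρ` of `φ'` is negative, then `φ'` decays geometrically along doublings;
if it is zero, then `φ` grows geometrically along doublings. -/
theorem exists_doubling_le {ρ : ℝ} (hρ : ρ ≤ 0) (hφ : RegularlyVarying (deriv φ) ρ)
    (hdiff : ∀ w, 0 < w → DifferentiableAt ℝ φ w)
    (hanti : AntitoneOn (deriv φ) (Ioi 0)) (hmono : MonotoneOn φ (Ioi 0))
    (hpos : ∀ w, 0 < w → 0 < φ w) :
    ∃ q, 0 ≤ q ∧ q < 1 ∧ ∀ᶠ w in atTop,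
      deriv φ (2 * w) / φ (2 * w) ^ 2 ≤ q * (deriv φ w / φ w ^ 2) := by
  rcases hρ.lt_or_eq with hρ | rfl
  · obtain ⟨q, hq0, hq1, hq⟩ := exists_deriv_doubling_le hρ hφ
    refine ⟨q, hq0, hq1, ?_⟩
    filter_upwards [hq, eventually_gt_atTop 0] with w hw hw0
    have h2w : 0 < 2 * w := by positivity
    have h1 : φ w ≤ φ (2 * w) := hmono hw0 h2w (by linarith)
    have h2 := hpos w hw0
    have h3 := (hφ.1 _ h2w).le
    have h4 := h3.trans hw
    rw [← mul_div_assoc]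
    gcongr
  · obtain ⟨C, hC, h⟩ := exists_le_mul_deriv hφ hdiff hanti hmono
    have hη : 1 < 1 + 3 / (4 * C) := by linarith [show 0 < 3 / (4 * C) by positivity]
    refine ⟨((1 + 3 / (4 * C)) ^ 2)⁻¹, by positivity,
      inv_lt_one_of_one_lt₀ (one_lt_pow₀ hη two_ne_zero), ?_⟩
    filter_upwards [h, eventually_gt_atTop 0] with w hw hw0
    have h2w : 0 < 2 * w := by positivity
    have h2 := hpos w hw0
    have h3 := (deriv_mul_le_sub hdiff hanti hw0 (show w < 2 * w by linarith)).1
    have h4 : (1 + 3 / (4 * C)) * φ w ≤ φ (2 * w) := by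
      have h5 : 3 / (4 * C) * φ w ≤ 3 / (4 * C) * (C * (w * deriv φ w)) := by
        gcongr; exact hw.1
      have h6 : 3 / (4 * C) * (C * (w * deriv φ w)) = w * (deriv φ w * (3 / 4)) := by
        field_simp
      have h7 := mul_le_mul_of_nonneg_left hw.2 hw0.le
      linarith
    have h8 : deriv φ (2 * w) ≤ deriv φ w := hanti hw0 h2w (by linarith)
    have h9 := (hφ.1 _ hw0).le
    calc deriv φ (2 * w) / φ (2 * w) ^ 2
        ≤ deriv φ w / ((1 + 3 / (4 * C)) * φ w) ^ 2 := by gcongr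
      _ = _ := by field_simp

end RegularVariation

/-! ### The Green function -/

section Green

variable {Ω : Type*} [MeasurableSpace Ω] {P : Measure Ω} {S : ℝ≥0 → Ω → ℝ}

theorem IsSubordinator.greenFunction_eq_lintegral [IsProbabilityMeasure P]
    (hS : IsSubordinator S P) {d : ℕ}
    (x y : EuclideanSpace ℝ (Fin d)) :
    greenFunction S P x y
      = ∫⁻ s in Ici 0, ENNReal.ofReal (gaussKernel d s ‖x - y‖) ∂(potentialMeasure S P) := by
  have hf : Measurable fun s => ENNReal.ofReal (gaussKernel d s ‖x - y‖) :=
    (measurable_gaussKernel d _).ennreal_ofReal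
  rw [← lintegral_indicator measurableSet_Ici, hS.lintegral_potentialMeasure
    (hf.indicator measurableSet_Ici)]
  simp_rw [lintegral_indicator measurableSet_Ici]
  rfl

theorem ae_potentialMeasure_pos {u : ℝ → ℝ} (hU : potentialMeasure S P =
      (volume.restrict (Ioi 0)).withDensity fun t => ENNReal.ofReal (u t)) :
    ∀ᵐ y ∂(potentialMeasure S P), y ∈ Ioi (0 : ℝ) := by
  rw [hU]
  exact (withDensity_absolutelyContinuous _ _).ae_le (ae_restrict_mem measurableSet_Ioi)

/-- The finiteness hypothesis is needed because `greenRadial` is a Bochner integral, which is `0` for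
a non-integrable kernel. -/
theorem ofReal_greenRadial {u : ℝ → ℝ} (hu : AntitoneOn u (Ioi 0)) (hU : potentialMeasure S P =
      (volume.restrict (Ioi 0)).withDensity fun t => ENNReal.ofReal (u t)) {d : ℕ} {r : ℝ}
    (hfin : ∫⁻ t in Ioi 0, ENNReal.ofReal (u t) * ENNReal.ofReal (gaussKernel d t r) ≠ ∞) :
    ENNReal.ofReal (greenRadial S P d r)
      = ∫⁻ t in Ioi 0, ENNReal.ofReal (u t) * ENNReal.ofReal (gaussKernel d t r) := by
  have hm := measurable_gaussKernel d r
  have hrestrict := Measure.restrict_eq_self_of_ae_mem (ae_potentialMeasure_pos hU)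
  have hnn : 0 ≤ᵐ[potentialMeasure S P] fun t => gaussKernel d t r := by
    filter_upwards [ae_potentialMeasure_pos hU] with t ht
    exact gaussKernel_nonneg d (le_of_lt ht) r
  have h : ∫⁻ t, ENNReal.ofReal (gaussKernel d t r) ∂(potentialMeasure S P)
      = ∫⁻ t in Ioi 0, ENNReal.ofReal (u t) * ENNReal.ofReal (gaussKernel d t r) := by
    rw [hU, lintegral_decreasing_density hu hm.ennreal_ofReal]
  rw [← h] at hfin ⊢
  rw [greenRadial, hrestrict]
  exact ofReal_integral_eq_lintegral_ofReal ⟨hm.aestronglyMeasurable,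
    (hasFiniteIntegral_iff_ofReal hnn).2 hfin.lt_top⟩ hnn

theorem greenRadial_nonneg (S : ℝ≥0 → Ω → ℝ) (P : Measure Ω) (d : ℕ) (r : ℝ) :
    0 ≤ greenRadial S P d r :=
  setIntegral_nonneg measurableSet_Ioi fun _ ht => gaussKernel_nonneg d (le_of_lt ht) r

end Green

/-! ### Asymptotic comparison at zero -/

theorem AsympNearZero.of_le_of_le {f h : ℝ → ℝ} {c C : ℝ} (hc : 0 < c) (hC : 0 < C)
    (hev : ∀ᶠ r in 𝓝[>] (0 : ℝ), 0 < h r ∧ c * h r ≤ f r ∧ f r ≤ C * h r) :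
    AsympNearZero f h := by
  refine ⟨c, C, hc, hC, ?_⟩
  filter_upwards [hev] with r hr
  exact ⟨(le_div_iff₀ hr.1).2 hr.2.1, (div_le_iff₀ hr.1).2 hr.2.2⟩

theorem tendsto_inv_sq_nhdsGT_zero : Tendsto (fun r : ℝ => (r ^ 2)⁻¹) (𝓝[>] 0) atTop := by
  refine tendsto_inv_nhdsGT_zero.comp (tendsto_nhdsWithin_iff.2 ⟨?_, ?_⟩)
  · have h : Tendsto (fun r : ℝ => r ^ 2) (𝓝 0) (𝓝 (0 ^ 2)) := (continuous_pow 2).tendsto 0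
    rw [zero_pow two_ne_zero] at h
    exact h.mono_left nhdsWithin_le_nhds
  · filter_upwards [self_mem_nhdsWithin] with r hr
    exact pow_pos (show (0 : ℝ) < r from hr) 2

end SubordinateBM

open SubordinateBM in
theorem mainTheorem4 {Ω : Type*} [MeasurableSpace Ω] (P : Measure Ω) [IsProbabilityMeasure P]
    (S : ℝ≥0 → Ω → ℝ) (hS : SubordinateBM.IsSubordinator S P)
    (d : ℕ) (hd : 3 ≤ d) (α : ℝ) (hα : α ∈ Icc (0 : ℝ) 2)
    (φ : ℝ → ℝ) (hφ : φ = SubordinateBM.laplaceExponent S P)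
    (hA1 : SubordinateBM.RegularlyVarying (deriv φ) (α / 2 - 1))
    (hA3 : SubordinateBM.HasDecreasingDensity (SubordinateBM.potentialMeasure S P)) :
    (∀ x y : EuclideanSpace ℝ (Fin d), x ≠ y →
      SubordinateBM.greenFunction S P x y
        = ENNReal.ofReal (SubordinateBM.greenRadial S P d ‖y - x‖)) ∧
    (α < 2 →
      SubordinateBM.AsympNearZero (SubordinateBM.greenRadial S P d)
        (fun r => r ^ (-(d : ℝ) - 2) * (deriv φ (r ^ (-2 : ℝ)) / φ (r ^ (-2 : ℝ)) ^ 2))) ∧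
    (α = 2 →
      SubordinateBM.AsympNearZero (SubordinateBM.greenRadial S P d)
        (fun r => r ^ (-(d : ℝ) + 2) * (1 / deriv φ (r ^ (-2 : ℝ)))) ∧
      SubordinateBM.AsympNearZero
        (fun r => r ^ (-(d : ℝ) + 2) * (1 / deriv φ (r ^ (-2 : ℝ))))
        (fun r => r ^ (-(d : ℝ)) * (1 / φ (r ^ (-2 : ℝ))))) := by
  obtain ⟨u, hu, hu0, hU⟩ := hA3
  subst hφ
  set φ := laplaceExponent S P with hφ
  have hpos : ∀ w, 0 < w → 0 < φ w := fun w hw => hS.laplaceExponent_pos hA1.1 hw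
  have hdiff : ∀ w, 0 < w → DifferentiableAt ℝ φ w := fun w hw =>
    hS.differentiableAt_laplaceExponent hw
  have hanti : AntitoneOn (deriv φ) (Ioi 0) := hS.antitoneOn_deriv_laplaceExponent
  have hmono : MonotoneOn φ (Ioi 0) := (hS.laplaceExponent_strictMonoOn hA1.1).monotoneOn
  set F : ℝ → ℝ := fun w => deriv φ w / φ w ^ 2 with hFdef
  have hFpos : ∀ w, 0 < w → 0 < F w := fun w hw => div_pos (hA1.1 w hw) (pow_pos (hpos w hw) 2)
  have hF0 : ∀ w, 0 < w → 0 ≤ F w := fun w hw => (hFpos w hw).le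
  have hF : ∀ w, 0 < w → ∫⁻ t in Ioi 0, ENNReal.ofReal (u t) *
      ENNReal.ofReal (t * Real.exp (-w * t)) = ENNReal.ofReal (F w) := by
    intro w hw
    rw [← hS.lintegral_mul_exp_potentialMeasure hA1.1
      ((ae_potentialMeasure_pos hU).mono fun y hy => le_of_lt hy) hw, hU,
      lintegral_decreasing_density hu (by fun_prop)]
  have hupper := fun {r : ℝ} (hr : 0 < r) => lintegral_gaussKernel_le hd hu hu0 hF0 hF hr
  have hgreen : ∀ {r : ℝ}, 0 < r → ENNReal.ofReal (greenRadial S P d r)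
      = ∫⁻ t in Ioi 0, ENNReal.ofReal (u t) * ENNReal.ofReal (gaussKernel d t r) :=
    fun hr => ofReal_greenRadial hu hU ((hupper hr).trans_lt ENNReal.ofReal_lt_top).ne
  have hinv : ∀ {r : ℝ}, 0 < r → r ^ (-2 : ℝ) = (r ^ 2)⁻¹ := fun {r} hr => by
    rw [Real.rpow_neg hr.le, Real.rpow_two]
  -- the two-sided bound by `r ^ (-d - 2) * F (r ^ (-2))` holds for every index
  obtain ⟨q, hq0, hq1, hq⟩ :=
    exists_doubling_le (by linarith [hα.2]) hA1 hdiff hanti hmono hpos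
  obtain ⟨c, hc, hcF⟩ := exists_le_density_mul_sq hu hu0 hF0 hF hq0 hq1 hq
  obtain ⟨c', hc', C', hC', hbound⟩ : ∃ c' > 0, ∃ C' > 0, ∀ᶠ r in 𝓝[>] (0 : ℝ),
      c' * (r ^ (-(d : ℝ) - 2) * F (r ^ (-2 : ℝ))) ≤ greenRadial S P d r ∧
        greenRadial S P d r ≤ C' * (r ^ (-(d : ℝ) - 2) * F (r ^ (-2 : ℝ))) := by
    refine ⟨(4 * Real.pi) ^ (-(d : ℝ) / 2) * Real.exp (-1 / 2) / 2 * c, by positivity,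
      (4 ^ d * (d.factorial : ℝ) + 4) * Real.exp 1, by positivity, ?_⟩
    filter_upwards [tendsto_inv_sq_nhdsGT_zero.eventually hcF, self_mem_nhdsWithin] with r hr hr0
    replace hr0 : 0 < r := hr0
    have hr2 : 0 < (r ^ 2)⁻¹ := by positivity
    rw [inv_inv] at hr
    rw [hinv hr0]
    have hFr := hF0 _ hr2
    have h1 := le_lintegral_gaussKernel d hu hu0 hr0
    have h2 := hupper hr0
    rw [← hgreen hr0, ENNReal.ofReal_le_ofReal_iff (greenRadial_nonneg S P d r)] at h1
    rw [← hgreen hr0, ENNReal.ofReal_le_ofReal_iff (by positivity)] at h2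
    refine ⟨le_trans ?_ h1, h2⟩
    rw [mul_assoc, mul_left_comm c]
    gcongr
  refine ⟨fun x y hxy => ?_, fun _ => ?_, fun hα2 => ?_⟩
  · rw [hS.greenFunction_eq_lintegral, norm_sub_rev x y,
      Measure.restrict_eq_self_of_ae_mem ((ae_potentialMeasure_pos hU).mono fun _ hs =>
        Ioi_subset_Ici_self hs), hgreen (norm_pos_iff.2 (sub_ne_zero.2 hxy.symm)), hU,
      lintegral_decreasing_density hu (measurable_gaussKernel d _).ennreal_ofReal]
  · refine AsympNearZero.of_le_of_le hc' hC' ?_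
    filter_upwards [hbound, self_mem_nhdsWithin] with r hr hr0
    replace hr0 : 0 < r := hr0
    exact ⟨mul_pos (Real.rpow_pos_of_pos hr0 _) (hFpos _ (Real.rpow_pos_of_pos hr0 _)), hr⟩
  · rw [show α / 2 - 1 = 0 by rw [hα2]; norm_num] at hA1
    obtain ⟨C, hC, hCφ⟩ := exists_le_mul_deriv hA1 hdiff hanti hmono
    -- the ratio `φ(w) / (w φ'(w))` lies in `[1, C]`
    have hratio : ∀ᶠ r in 𝓝[>] (0 : ℝ), 0 < r ∧ 0 < deriv φ (r ^ (-2 : ℝ)) ∧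
        r ^ (-2 : ℝ) * deriv φ (r ^ (-2 : ℝ)) ≤ φ (r ^ (-2 : ℝ)) ∧
        φ (r ^ (-2 : ℝ)) ≤ C * (r ^ (-2 : ℝ) * deriv φ (r ^ (-2 : ℝ))) := by
      filter_upwards [tendsto_inv_sq_nhdsGT_zero.eventually hCφ, self_mem_nhdsWithin]
        with r hr hr0
      replace hr0 : 0 < r := hr0
      have hr2 : 0 < (r ^ 2)⁻¹ := by positivity
      rw [hinv hr0]
      exact ⟨hr0, hA1.1 _ hr2, mul_deriv_le hdiff hanti (fun w hw => (hpos w hw).le) hr2, hr.1⟩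
    have hsplit : ∀ {r : ℝ}, 0 < r → r ^ (-(d : ℝ) + 2) = r ^ (-(d : ℝ) - 2) / (r ^ (-2 : ℝ)) ^ 2 ∧
        r ^ (-(d : ℝ) + 2) = r ^ (-(d : ℝ)) / r ^ (-2 : ℝ) := fun {r} hr => by
      rw [← Real.rpow_natCast (r ^ (-2 : ℝ)) 2, ← Real.rpow_mul hr.le, ← Real.rpow_sub hr,
        ← Real.rpow_sub hr]
      constructor <;> · congr 1; push_cast; ring
    constructor
    · refine AsympNearZero.of_le_of_le (c := c' / C ^ 2) (C := C') (by positivity) hC' ?_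
      filter_upwards [hbound, hratio] with r hr ⟨hr0, h1, h2, h3⟩
      have hw : 0 < r ^ (-2 : ℝ) := Real.rpow_pos_of_pos hr0 _
      have hr' : 0 < r ^ (-(d : ℝ) - 2) := Real.rpow_pos_of_pos hr0 _
      rw [(hsplit hr0).1]
      generalize r ^ (-2 : ℝ) = w at *
      have hφw := hpos w hw
      refine ⟨by positivity, le_trans ?_ hr.1, hr.2.trans ?_⟩
      · rw [div_mul_eq_mul_div, mul_div_assoc]
        refine mul_le_mul_of_nonneg_left ?_ hc'.le
        calc r ^ (-(d : ℝ) - 2) / w ^ 2 * (1 / deriv φ w) / C ^ 2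
            = r ^ (-(d : ℝ) - 2) * (deriv φ w / (C * (w * deriv φ w)) ^ 2) := by field_simp
          _ ≤ r ^ (-(d : ℝ) - 2) * F w := by simp only [hFdef]; gcongr
      · refine mul_le_mul_of_nonneg_left ?_ hC'.le
        calc r ^ (-(d : ℝ) - 2) * F w
            ≤ r ^ (-(d : ℝ) - 2) * (deriv φ w / (w * deriv φ w) ^ 2) := by
              simp only [hFdef]; gcongr
          _ = r ^ (-(d : ℝ) - 2) / w ^ 2 * (1 / deriv φ w) := by field_simp
    · refine AsympNearZero.of_le_of_le (c := 1) (C := C) one_pos hC ?_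
      filter_upwards [hratio] with r ⟨hr0, h1, h2, h3⟩
      have hw : 0 < r ^ (-2 : ℝ) := Real.rpow_pos_of_pos hr0 _
      have hr' : 0 < r ^ (-(d : ℝ)) := Real.rpow_pos_of_pos hr0 _
      rw [(hsplit hr0).2]
      generalize r ^ (-2 : ℝ) = w at *
      have hφw := hpos w hw
      refine ⟨by positivity, ?_, ?_⟩
      · calc 1 * (r ^ (-(d : ℝ)) * (1 / φ w))
            ≤ r ^ (-(d : ℝ)) * (1 / (w * deriv φ w)) := by rw [one_mul]; gcongr
          _ = r ^ (-(d : ℝ)) / w * (1 / deriv φ w) := by field_simp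
      · calc r ^ (-(d : ℝ)) / w * (1 / deriv φ w)
            = C * (r ^ (-(d : ℝ)) * (1 / (C * (w * deriv φ w)))) := by field_simp
          _ ≤ C * (r ^ (-(d : ℝ)) * (1 / φ w)) := by gcongr
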